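/- Let $G=(V,E)$ be a path with $|V|\ge 3$, let $N\ge 3$, $\gamma\in(0,1)$ and $\varepsilon=0$. There are $N$ tokens on $G$: cops $C_1,\dots,C_{N-1}$ (tokens $1,\dots,N-1$) and a robber $R$ (token $N$). A state $s=(x^1,\dots,x^N,n)$ records the vertex $x^i$ of each token and the token $n$ that moves next; it is a capture state if $x^i=x^N$ for some $i<N$. In each turn the token whose turn it is stays put or moves to an adjacent vertex, and the turn passes in the cyclic order $C_1,\dots,C_{N-1},R,C_1,\dots$; the game is over at the first capture state, whose time $t$ (number of turns made) is the capture time. For $m\in\{1,\dots,N\}$, $\Gamma_N^m$ is the two-player zero-sum game in which $P_m$ controls token $m$ and $P_{-m}$ all other tokens. In $\Gamma^N_N$ (the modified cops and robber game), $P_N$'s payoff is $-\gamma^t$. For $m<N$, if $K$ cops are on the robber's vertex at the capture time $t$, $P_m$'s payoff is $\frac{\gamma^t}{N-1}$ if $K=N-1$; otherwise it is $\frac{1-\varepsilon}{K}\gamma^t$ if $C_m$ is among them, and $\frac{\varepsilon}{N-K-1}\gamma^t$ if not (so $\frac{\gamma^t}{K}$ and $0$, as $\varepsilon=0$). If there is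 no capture all payoffs are $0$. Strategies in these games are pure and positional (a move for each state), and a strategy of $P_m$ or of $P_{-m}$ (the latter being a vector with one strategy for each of its tokens) is optimal if it guarantees the value of the game from every noncapture starting state. A strategy of token $n$ is called CR-optimal if it is (for $n<N$: a component of) an optimal strategy of the player who controls token $n$ in $\Gamma_N^N$. A trigger strategies profile $\overline\sigma=(\overline\sigma^1,\dots,\overline\sigma^N)$ of the $N$-player game $\Gamma_N(G|s_0,\gamma,\varepsilon)$ with noncapture initial state $s_0$ is composed of strategies $\phi_m^n$ ($m,n\in\{1,\dots,N\}$) such that, for every $m$, $\phi_m^m$ is optimal for $P_m$ and $(\phi_m^n)_{n\neq m}$ is optimal for $P_{-m}$ in $\Gamma_N^m$: after a history from $s_0$ with current state $s$, $\overline\sigma^n$ prescribes $\phi_n^n(s)$ as long as every other player $m$ has followed $\phi_m^m$, and $\phi_m^n(s)$ once some other player $m$ has deviated (the first to do so). The profile is called positional if for all $n,m\in\{1,\dots,N\}$ there is a CR-optimal strategy $\widehat\sigma^n$ of token $n$ such that $\phi^n_m(s)=\widehat\sigma^n(s)$ for every noncapture state $s$ in which token $n$ has the move and which is the last state of a finite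 history of legal moves starting at $s_0$. Then $\Gamma_N(G|s_0,\gamma,0)$ has a positional trigger strategies profile if and only if (i) in $s_0$ all cops are on one and the same side of the robber on the path, and (ii) $\gamma\le\frac{1}{N-1}$. Moreover, if (i) and (ii) hold, there is a positional trigger strategies profile in which, in addition, each $\overline\sigma^n$, on the finite histories from $s_0$ that end in a noncapture state where token $n$ has the move, depends only on the current state. -/

import Mathlib

/-!
Tokens are indexed by `Fin (c + 1)`: the indices `0, …, c - 1` are the `c = N - 1` cops
(in the order in which they move), and `Fin.last c` is the robber (the `N`-th token).
-/

namespace SCAR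

/-- A (nonterminal) state: the location of every token and the token that moves next. -/
@[ext]
structure State (V : Type*) (c : ℕ) where
  pos : Fin (c + 1) → V
  mover : Fin (c + 1)

variable {V : Type*} {c : ℕ}

/-- Some cop is on the vertex of the robber. -/
def State.IsCapture (s : State V c) : Prop :=
  ∃ i : Fin c, s.pos i.castSucc = s.pos (Fin.last c)

/-- The state after the token to move goes to `w`; the turn passes cyclically to the next token
(`Fin.last c + 1 = 0`, so that the first cop moves after the robber). -/
def State.next (s : State V c) (w : V) : State V c where
  pos := Function.update s.pos s.mover w
  mover := s.mover + 1

/-- The token to move may stay where it is or move to a neighbouring vertex. -/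
def State.Legal (G : SimpleGraph V) (s : State V c) (w : V) : Prop :=
  w = s.pos s.mover ∨ G.Adj (s.pos s.mover) w

/-- A pure positional strategy for token `n`
(its values at states where `n` does not have the move are irrelevant). -/
structure Strategy (G : SimpleGraph V) (n : Fin (c + 1)) where
  move : State V c → V
  legal : ∀ s : State V c, s.mover = n → s.Legal G (move s)

/-- A profile of pure positional strategies, one for each token. -/
abbrev Profile (G : SimpleGraph V) (c : ℕ) : Type _ :=
  (n : Fin (c + 1)) → Strategy G n

/-- The state after `t` turns when play starts at `s` and follows the profile `π`. -/
def play {G : SimpleGraph V} (π : Profile G c) (s : State V c) : ℕ → State V c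
  | 0 => s
  | t + 1 => (play π s t).next ((π (play π s t).mover).move (play π s t))

/-- The number of cops on the vertex of the robber. -/
noncomputable def State.captors (s : State V c) : ℕ :=
  Nat.card {i : Fin c // s.pos i.castSucc = s.pos (Fin.last c)}

open Classical in
/-- The undiscounted payoff, at a capture state, of player `P_m` in the auxiliary zero-sum game
`Γ^m` in which `P_m` controls token `m` and `P_{-m}` controls all other tokens. For the robber
(`m = Fin.last c`) this is the modified cops and robber game. -/
noncomputable def reward (ε : ℝ) (m : Fin (c + 1)) (s : State V c) : ℝ :=
  if m = Fin.last c then -1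
  else if s.captors = c then 1 / (c : ℝ)
  else if s.pos m = s.pos (Fin.last c) then (1 - ε) / (s.captors : ℝ)
  else ε / ((c : ℝ) - (s.captors : ℝ))

open Classical in
/-- The payoff of `P_m` in the game `Γ^m` started at `s`, under the profile `π`: the reward at
the first capture state, discounted by `γ ^ t` where `t` is the capture time, and `0` if capture
never takes place. The payoff of `P_{-m}` is the negative of this number. -/
noncomputable def payoff {G : SimpleGraph V} (γ ε : ℝ) (m : Fin (c + 1)) (π : Profile G c)
    (s : State V c) : ℝ :=
  if h : ∃ t, (play π s t).IsCapture then
    γ ^ Nat.find h * reward ε m (play π s (Nat.find h))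
  else 0

/-- With the strategy `σ` for token `m`, player `P_m` gets at least `v` in `Γ^m` started at `s`,
whatever `P_{-m}` does. -/
def Guarantees {G : SimpleGraph V} (γ ε : ℝ) (m : Fin (c + 1)) (σ : Strategy G m)
    (s : State V c) (v : ℝ) : Prop :=
  ∀ ρ : Profile G c, ρ m = σ → v ≤ payoff γ ε m ρ s

/-- With the strategies `π k`, `k ≠ m`, player `P_{-m}` loses at most `v` in `Γ^m` started at `s`,
whatever `P_m` does (the component `π m` plays no role). -/
def CoGuarantees {G : SimpleGraph V} (γ ε : ℝ) (m : Fin (c + 1)) (π : Profile G c)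
    (s : State V c) (v : ℝ) : Prop :=
  ∀ ρ : Profile G c, (∀ k, k ≠ m → ρ k = π k) → payoff γ ε m ρ s ≤ v

/-- `v` is the value of the zero-sum game `Γ^m` started at `s`. -/
def IsValue (G : SimpleGraph V) (γ ε : ℝ) (m : Fin (c + 1)) (s : State V c) (v : ℝ) : Prop :=
  (∃ σ : Strategy G m, Guarantees γ ε m σ s v) ∧
    ∃ π : Profile G c, CoGuarantees γ ε m π s v

/-- `π` is optimal in `Γ^m`: from every noncapture state, `π m` guarantees the value to `P_m` and
the strategies `π k`, `k ≠ m`, together guarantee it to `P_{-m}`. -/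
def IsOptimal {G : SimpleGraph V} (γ ε : ℝ) (m : Fin (c + 1)) (π : Profile G c) : Prop :=
  ∀ s : State V c, ¬ s.IsCapture → ∃ v, IsValue G γ ε m s v ∧
    Guarantees γ ε m (π m) s v ∧ CoGuarantees γ ε m π s v

/-- The optimal strategies of token `n` in `Γ^m`. For `m = Fin.last c` these are the CR-optimal
strategies of token `n`. -/
def optimalStrategies (G : SimpleGraph V) (γ ε : ℝ) (m n : Fin (c + 1)) : Set (Strategy G n) :=
  {σ | ∃ π : Profile G c, IsOptimal γ ε m π ∧ π n = σ}

/-- Finite histories of legal moves from `s₀`, the most recent state first. No move is made after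
a capture. -/
inductive IsHistory (G : SimpleGraph V) (s₀ : State V c) : List (State V c) → Prop
  | start : IsHistory G s₀ [s₀]
  | step (s : State V c) (h : List (State V c)) (w : V) :
      IsHistory G s₀ (s :: h) → ¬ s.IsCapture → s.Legal G w → IsHistory G s₀ (s.next w :: s :: h)

/-- The data of a trigger strategies profile: for every `m`, optimal strategies
`φ m n` of all tokens `n` in the game `Γ^m`. -/
def IsTriggerFamily {G : SimpleGraph V} (γ ε : ℝ) (φ : Fin (c + 1) → Profile G c) : Prop :=
  ∀ m, IsOptimal γ ε m (φ m)

open Classical in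
/-- The first player `m ≠ n` who, along a history (most recent state first), has deviated from
his strategy `φ m m`. -/
noncomputable def firstDeviator {G : SimpleGraph V} (φ : Fin (c + 1) → Profile G c)
    (n : Fin (c + 1)) : List (State V c) → Option (Fin (c + 1))
  | s' :: s :: h =>
    match firstDeviator φ n (s :: h) with
    | some m => some m
    | none =>
      if s.mover ≠ n ∧ s'.pos s.mover ≠ (φ s.mover s.mover).move s then some s.mover else none
  | _ => none

/-- The trigger strategy of token `n` composed from `φ`, at a history `s :: h` with current state
`s`: play `φ n n` as long as every other player `m` follows `φ m m`, and `φ m n` as soon as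
some other player `m` deviates from `φ m m`. -/
noncomputable def triggerMove {G : SimpleGraph V} (φ : Fin (c + 1) → Profile G c)
    (n : Fin (c + 1)) (s : State V c) (h : List (State V c)) : V :=
  match firstDeviator φ n (s :: h) with
  | none => (φ n n).move s
  | some m => (φ m n).move s

/-- The positionality condition for the trigger strategies profile composed from `φ`: for all
tokens `n` and all `m`, the strategy `φ m n` agrees with some CR-optimal strategy of token `n` at
all noncapture states where `n` has the move and which end a history from `s₀`. -/
def IsPositional {G : SimpleGraph V} (γ ε : ℝ) (s₀ : State V c)
    (φ : Fin (c + 1) → Profile G c) : Prop :=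
  ∀ n m : Fin (c + 1), ∃ σ ∈ optimalStrategies G γ ε (Fin.last c) n,
    ∀ (s : State V c) (h : List (State V c)), IsHistory G s₀ (s :: h) → s.mover = n →
      ¬ s.IsCapture → (φ m n).move s = σ.move s

/-- Every trigger strategy composed from `φ`, as a function of noncapture histories from `s₀` at
whose end its token has the move, depends only on the current state. -/
def IsHistoryIndependent {G : SimpleGraph V} (s₀ : State V c)
    (φ : Fin (c + 1) → Profile G c) : Prop :=
  ∀ n : Fin (c + 1), ∃ f : State V c → V,
    ∀ (s : State V c) (h : List (State V c)), IsHistory G s₀ (s :: h) → s.mover = n →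
      ¬ s.IsCapture → triggerMove φ n s h = f s

/-- On a path with vertices ordered by `e`, all cops are on one side of the robber. -/
def State.OneSided {k : ℕ} {G : SimpleGraph V} (e : G ≃g SimpleGraph.pathGraph k)
    (s : State V c) : Prop :=
  (∀ i : Fin c, e (s.pos i.castSucc) < e (s.pos (Fin.last c))) ∨
    ∀ i : Fin c, e (s.pos (Fin.last c)) < e (s.pos i.castSucc)

end SCAR

namespace SCAR

variable {V : Type*} {c : ℕ}

/-! Each game `Γ^m` is a discounted game on a finite state space, so its values solve Bellman
equations, and a profile is optimal exactly when every move it makes attains them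
(`IsBellman.isOptimal_iff`). Positionality thus becomes a local condition: at every reachable
noncapture state and for every `m`, some move must be greedy both in `Γ^m` and in the cops and
robber game. Conversely, if at each reachable state one move is greedy in all games at once, using
it everywhere makes punishment indistinguishable from cooperation
(`exists_family_of_common_greedy`).

Sufficiency: after a reflection all cops lie above the robber, and this persists until capture.
Everybody moving towards coordinate `0` is greedy in all games. This is verified with explicit
values: `-γ ^ T` for the robber, where `T` is the first catch time, and in the game of a cop `γ ^ T`
if he is the one who makes that catch, otherwise `0`, as `ε = 0` (`IsBellman.greedy_last`,
`IsBellman.greedy_castSucc`). The bound `γ ≤ 1 / c` stops the robber from spoiling the leader's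
reward by running into a crowd of cops.

Necessity: since tokens may stay, the cops can be brought next to the robber, with the robber at an
end of the path in the one-sided case, and the robber to move. Every neighbouring vertex is then
occupied, so his only CR-optimal move is to stay. In the game of the first cop, who moves next and
captures alone, staying concedes at least `γ ^ 2`, while running into cops concedes `γ` times the
first cop's reward; so that reward must be at least `γ` (`le_reward_of_common_greedy`). It is `1 /
c` if all cops share a vertex, and `0` if the robber runs to the side without the first cop
(`le_of_common_greedy`). -/

theorem State.legal_stay (G : SimpleGraph V) (s : State V c) : s.Legal G (s.pos s.mover) :=
  Or.inl rfl

/-! ### Existence of solutions of the Bellman equations -/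

/-- A maximum principle: the difference of two functions on a finite set is nonpositive if it is
contracted along some successor at every point where it is positive. -/
theorem le_of_contraction {S : Type*} [Finite S] {A : Set S} {f g : S → ℝ} {γ : ℝ}
    (hγ : γ < 1)
    (h : ∀ s ∈ A, f s ≤ g s ∨ ∃ s' ∈ A, f s - g s ≤ γ * (f s' - g s')) (hγ₀ : 0 ≤ γ) :
    ∀ s ∈ A, f s ≤ g s := by
  intro s hs
  obtain ⟨a, ha, hmax⟩ := Set.exists_max_image A (fun s => f s - g s) A.toFinite ⟨s, hs⟩
  have key : f a - g a ≤ 0 := by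
    rcases h a ha with h1 | ⟨b, hb, h1⟩
    · linarith
    · have h2 := hmax b hb
      have h3 : γ * (f b - g b) ≤ γ * (f a - g a) := mul_le_mul_of_nonneg_left h2 hγ₀
      by_contra hpos
      push Not at hpos
      nlinarith
  linarith [hmax s hs]

instance [Finite V] : Finite (State V c) :=
  Finite.of_injective (fun s : State V c => (s.pos, s.mover)) fun s t h => by
    simp only [Prod.mk.injEq] at h
    exact State.ext h.1 h.2

/-- The Bellman equations of the game `Γ^m`. -/
structure IsBellman (G : SimpleGraph V) (γ ε : ℝ) (m : Fin (c + 1)) (v : State V c → ℝ) :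
    Prop where
  capture : ∀ s, s.IsCapture → v s = reward ε m s
  greedy : ∀ s, ¬ s.IsCapture → ∃ w, s.Legal G w ∧ v s = γ * v (s.next w)
  le_self : ∀ s, ¬ s.IsCapture → s.mover = m → ∀ w, s.Legal G w → γ * v (s.next w) ≤ v s
  self_le : ∀ s, ¬ s.IsCapture → s.mover ≠ m → ∀ w, s.Legal G w → v s ≤ γ * v (s.next w)

open Classical in
/-- The moves available at a state. -/
noncomputable def State.moves [Fintype V] (G : SimpleGraph V) (s : State V c) : Finset V :=
  Finset.univ.filter (s.Legal G)

theorem State.mem_moves [Fintype V] {G : SimpleGraph V} {s : State V c} {w : V} :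
    w ∈ s.moves G ↔ s.Legal G w := by
  simp [State.moves]

theorem State.moves_nonempty [Fintype V] (G : SimpleGraph V) (s : State V c) :
    (s.moves G).Nonempty :=
  ⟨_, State.mem_moves.2 (s.legal_stay G)⟩

open Classical in
/-- The Bellman operator of the game `Γ^m`. -/
noncomputable def bellmanOp [Fintype V] (G : SimpleGraph V) (γ ε : ℝ) (m : Fin (c + 1))
    (f : State V c → ℝ) (s : State V c) : ℝ :=
  if s.IsCapture then reward ε m s
  else if s.mover = m then γ * (s.moves G).sup' (s.moves_nonempty G) fun w => f (s.next w)
  else γ * (s.moves G).inf' (s.moves_nonempty G) fun w => f (s.next w)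

/-- Applied in both directions with `d = dist f g`, this makes the operator a `γ`-contraction in the
sup metric, so that Banach's theorem provides a fixed point. -/
theorem bellmanOp_le_add [Fintype V] (G : SimpleGraph V) {γ : ℝ} (ε : ℝ) (hγ : 0 ≤ γ)
    (m : Fin (c + 1)) {f g : State V c → ℝ} {d : ℝ} (hd : 0 ≤ d) (h : ∀ s, f s ≤ g s + d)
    (s : State V c) : bellmanOp G γ ε m f s ≤ bellmanOp G γ ε m g s + γ * d := by
  unfold bellmanOp
  split_ifs
  · nlinarith
  · rw [← mul_add]
    refine mul_le_mul_of_nonneg_left (Finset.sup'_le _ _ fun w hw => (h _).trans ?_) hγ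
    gcongr
    exact Finset.le_sup' (fun w => g (s.next w)) hw
  · rw [← mul_add]
    refine mul_le_mul_of_nonneg_left ?_ hγ
    rw [← sub_le_iff_le_add]
    refine Finset.le_inf' _ _ fun w hw => ?_
    rw [sub_le_iff_le_add]
    exact (Finset.inf'_le (fun w => f (s.next w)) hw).trans (h _)

theorem exists_bellmanOp_fixedPoint [Fintype V] (G : SimpleGraph V) {γ : ℝ} (ε : ℝ) (hγ₀ : 0 ≤ γ)
    (hγ₁ : γ < 1) (m : Fin (c + 1)) : ∃ v : State V c → ℝ, bellmanOp G γ ε m v = v := by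
  have := Fintype.ofFinite (State V c)
  have hK : ContractingWith (⟨γ, hγ₀⟩ : NNReal) (bellmanOp (c := c) G γ ε m) := by
    refine ⟨by exact_mod_cast hγ₁, LipschitzWith.of_dist_le_mul fun f g => ?_⟩
    refine (dist_pi_le_iff (by positivity)).2 fun s => ?_
    have hfg : ∀ s, |f s - g s| ≤ dist f g := fun s => dist_le_pi_dist f g s
    have h1 := bellmanOp_le_add G ε hγ₀ m (f := f) (g := g) dist_nonneg
      (fun s => by linarith [(abs_le.1 (hfg s)).2]) s
    have h2 := bellmanOp_le_add G ε hγ₀ m (f := g) (g := f) dist_nonneg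
      (fun s => by linarith [(abs_le.1 (hfg s)).1]) s
    change |_ - _| ≤ γ * dist f g
    rw [abs_le]
    constructor <;> linarith
  exact ⟨_, hK.fixedPoint_isFixedPt⟩

theorem exists_isBellman [Fintype V] (G : SimpleGraph V) {γ : ℝ} (ε : ℝ) (hγ₀ : 0 ≤ γ)
    (hγ₁ : γ < 1) (m : Fin (c + 1)) : ∃ v : State V c → ℝ, IsBellman G γ ε m v := by
  obtain ⟨v, hv⟩ := exists_bellmanOp_fixedPoint (c := c) G ε hγ₀ hγ₁ m
  have hv' := fun s => (congrFun hv s).symm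
  refine ⟨v, fun s hs => ?_, fun s hs => ?_, fun s hs hm w hw => ?_, fun s hs hm w hw => ?_⟩
  · rw [hv', bellmanOp, if_pos hs]
  · by_cases hm : s.mover = m
    · obtain ⟨w, hw, h⟩ :=
        Finset.exists_mem_eq_sup' (s.moves_nonempty G) fun w => v (s.next w)
      refine ⟨w, State.mem_moves.1 hw, ?_⟩
      rw [← h, hv' s, bellmanOp, if_neg hs, if_pos hm]
    · obtain ⟨w, hw, h⟩ :=
        Finset.exists_mem_eq_inf' (s.moves_nonempty G) fun w => v (s.next w)
      refine ⟨w, State.mem_moves.1 hw, ?_⟩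
      rw [← h, hv' s, bellmanOp, if_neg hs, if_neg hm]
  · rw [hv' s, bellmanOp, if_neg hs, if_pos hm]
    exact mul_le_mul_of_nonneg_left
      (Finset.le_sup' (fun w => v (s.next w)) (State.mem_moves.2 hw)) hγ₀
  · rw [hv' s, bellmanOp, if_neg hs, if_neg hm]
    exact mul_le_mul_of_nonneg_left
      (Finset.inf'_le (fun w => v (s.next w)) (State.mem_moves.2 hw)) hγ₀

/-! ### Bellman equations, values and optimal strategies -/

section Payoff

variable {G : SimpleGraph V} {γ ε : ℝ} {m : Fin (c + 1)}

open Classical in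
theorem payoff_of_isCapture (π : Profile G c) {s : State V c} (hs : s.IsCapture) :
    payoff γ ε m π s = reward ε m s := by
  have h : ∃ t, (play π s t).IsCapture := ⟨0, hs⟩
  have h0 : Nat.find h = 0 := (Nat.find_eq_zero h).2 hs
  rw [payoff, dif_pos h, h0]
  simp [play]

theorem play_succ' (π : Profile G c) (s : State V c) (t : ℕ) :
    play π s (t + 1) = play π (s.next ((π s.mover).move s)) t := by
  induction t with
  | zero => rfl
  | succ t ih => rw [play, ih, play]

open Classical in
theorem payoff_of_not_isCapture (π : Profile G c) {s : State V c} (hs : ¬ s.IsCapture) :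
    payoff γ ε m π s = γ * payoff γ ε m π (s.next ((π s.mover).move s)) := by
  by_cases h : ∃ t, (play π s t).IsCapture
  · have h' : ∃ t, (play π s (t + 1)).IsCapture := by
      obtain ⟨t, ht⟩ := h
      cases t with
      | zero => exact absurd ht hs
      | succ t => exact ⟨t, ht⟩
    have h'' : ∃ t, (play π (s.next ((π s.mover).move s)) t).IsCapture := by
      simpa only [play_succ'] using h'
    have e1 : Nat.find h = Nat.find h' + 1 := Nat.find_comp_succ h h' hs
    have e2 : Nat.find h' = Nat.find h'' :=
      Nat.find_congr' fun {t} => by rw [play_succ']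
    rw [payoff, dif_pos h, payoff, dif_pos h'', e1, e2, play_succ', pow_succ]
    ring
  · have h'' : ¬ ∃ t, (play π (s.next ((π s.mover).move s)) t).IsCapture := by
      rintro ⟨t, ht⟩
      exact h ⟨t + 1, by rwa [play_succ']⟩
    rw [payoff, dif_neg h, payoff, dif_neg h'', mul_zero]

variable {v : State V c → ℝ}

theorem IsBellman.exists_profile (hv : IsBellman G γ ε m v) :
    ∃ π : Profile G c, ∀ s, ¬ s.IsCapture → v s = γ * v (s.next ((π s.mover).move s)) := by
  have : ∀ s : State V c, ∃ w, s.Legal G w ∧ (¬ s.IsCapture → v s = γ * v (s.next w)) := by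
    intro s
    by_cases hs : s.IsCapture
    · exact ⟨_, s.legal_stay G, fun h => absurd hs h⟩
    · obtain ⟨w, h1, h2⟩ := hv.greedy s hs
      exact ⟨w, h1, fun _ => h2⟩
  choose F hF1 hF2 using this
  exact ⟨fun n => ⟨F, fun s _ => hF1 s⟩, hF2⟩

theorem exists_profile_eq_and_eq {σ : Strategy G m} {π : Profile G c} :
    ∃ ρ : Profile G c, ρ m = σ ∧ ∀ k, k ≠ m → ρ k = π k :=
  ⟨Function.update π m σ, Function.update_self .., fun _ hk => Function.update_of_ne hk ..⟩

variable [Finite V]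

theorem IsBellman.guarantees (hv : IsBellman G γ ε m v) (hγ₀ : 0 ≤ γ) (hγ₁ : γ < 1)
    {σ : Strategy G m}
    (hσ : ∀ s, ¬ s.IsCapture → s.mover = m → v s = γ * v (s.next (σ.move s)))
    (s : State V c) : Guarantees γ ε m σ s (v s) := by
  intro ρ hρ
  refine le_of_contraction (A := Set.univ) hγ₁ (fun s _ => ?_) hγ₀ s trivial
  by_cases hs : s.IsCapture
  · left
    rw [hv.capture s hs, payoff_of_isCapture ρ hs]
  · right
    refine ⟨s.next ((ρ s.mover).move s), trivial, ?_⟩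
    rw [payoff_of_not_isCapture ρ hs]
    have : v s ≤ γ * v (s.next ((ρ s.mover).move s)) := by
      by_cases hm : s.mover = m
      · have := hσ s hs hm
        subst hm
        rw [hρ]
        exact this.le
      · exact hv.self_le s hs hm _ ((ρ s.mover).legal s rfl)
    linarith

theorem IsBellman.coGuarantees (hv : IsBellman G γ ε m v) (hγ₀ : 0 ≤ γ) (hγ₁ : γ < 1)
    {π : Profile G c}
    (hπ : ∀ s, ¬ s.IsCapture → s.mover ≠ m → v s = γ * v (s.next ((π s.mover).move s)))
    (s : State V c) : CoGuarantees γ ε m π s (v s) := by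
  intro ρ hρ
  refine le_of_contraction (A := Set.univ) hγ₁ (fun s _ => ?_) hγ₀ s trivial
  by_cases hs : s.IsCapture
  · left
    rw [hv.capture s hs, payoff_of_isCapture ρ hs]
  · right
    refine ⟨s.next ((ρ s.mover).move s), trivial, ?_⟩
    rw [payoff_of_not_isCapture ρ hs]
    have : γ * v (s.next ((ρ s.mover).move s)) ≤ v s := by
      by_cases hm : s.mover = m
      · exact hv.le_self s hs hm _ ((ρ s.mover).legal s rfl)
      · rw [hρ _ hm]
        exact (hπ s hs hm).ge
    linarith

theorem IsBellman.eq_of_isValue (hv : IsBellman G γ ε m v) (hγ₀ : 0 ≤ γ) (hγ₁ : γ < 1)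
    {s : State V c} {a : ℝ} (ha : IsValue G γ ε m s a) : a = v s := by
  obtain ⟨⟨σ, hσ⟩, π, hπ⟩ := ha
  obtain ⟨π', hπ'⟩ := hv.exists_profile
  refine le_antisymm ?_ ?_
  · obtain ⟨ρ, h1, h2⟩ := exists_profile_eq_and_eq (σ := σ) (π := π')
    exact (hσ ρ h1).trans (hv.coGuarantees hγ₀ hγ₁ (fun s hs _ => hπ' s hs) s ρ h2)
  · obtain ⟨ρ, h1, h2⟩ := exists_profile_eq_and_eq (σ := π' m) (π := π)
    refine (hv.guarantees hγ₀ hγ₁ (fun s hs hm => ?_) s ρ h1).trans (hπ ρ h2)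
    have := hπ' s hs
    subst hm
    exact this

/-- A profile is optimal if and only if all its moves attain the optimum in the Bellman
equations. -/
theorem IsBellman.isOptimal_iff (hv : IsBellman G γ ε m v) (hγ₀ : 0 ≤ γ) (hγ₁ : γ < 1)
    (π : Profile G c) : IsOptimal γ ε m π ↔
      ∀ s, ¬ s.IsCapture → v s = γ * v (s.next ((π s.mover).move s)) := by
  constructor
  · intro h
    have hopt : ∀ s, ¬ s.IsCapture →
        Guarantees γ ε m (π m) s (v s) ∧ CoGuarantees γ ε m π s (v s) := by
      intro s hs
      obtain ⟨a, h1, h2, h3⟩ := h s hs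
      rw [hv.eq_of_isValue hγ₀ hγ₁ h1] at h2 h3
      exact ⟨h2, h3⟩
    intro s hs
    obtain ⟨π', hπ'⟩ := hv.exists_profile
    have hleg := (π s.mover).legal s rfl
    by_cases hm : s.mover = m
    · refine le_antisymm ?_ (hv.le_self s hs hm _ hleg)
      -- Pit `π m` against greedy opponents: optimality bounds the payoff at `s` from below,
      -- greediness bounds the payoff after one move from above, and the two payoffs differ by the
      -- factor `γ`.
      obtain ⟨ρ, h1, h2⟩ := exists_profile_eq_and_eq (σ := π m) (π := π')
      have h3 := (hopt s hs).1 ρ h1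
      have h4 := hv.coGuarantees hγ₀ hγ₁ (fun s hs _ => hπ' s hs)
        (s.next ((ρ s.mover).move s)) ρ h2
      rw [payoff_of_not_isCapture ρ hs] at h3
      have h5 : ρ s.mover = π s.mover := by
        subst hm
        exact h1
      rw [h5] at h3 h4
      exact h3.trans (mul_le_mul_of_nonneg_left h4 hγ₀)
    · refine le_antisymm (hv.self_le s hs hm _ hleg) ?_
      obtain ⟨ρ, h1, h2⟩ := exists_profile_eq_and_eq (σ := π' m) (π := π)
      have h3 := (hopt s hs).2 ρ h2
      have h4 := hv.guarantees hγ₀ hγ₁ (σ := π' m) (fun s hs hm => by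
        have := hπ' s hs
        subst hm
        exact this) (s.next ((ρ s.mover).move s)) ρ h1
      rw [payoff_of_not_isCapture ρ hs, h2 _ hm] at h3
      rw [h2 _ hm] at h4
      exact (mul_le_mul_of_nonneg_left h4 hγ₀).trans h3
  · intro h s _
    have h1 : Guarantees γ ε m (π m) s (v s) :=
      hv.guarantees hγ₀ hγ₁ (fun s hs hm => by
        have := h s hs
        subst hm
        exact this) s
    have h2 := hv.coGuarantees hγ₀ hγ₁ (fun s hs _ => h s hs) s
    exact ⟨v s, ⟨⟨_, h1⟩, _, h2⟩, h1, h2⟩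

/-- A function that satisfies the Bellman equations on a set of states closed under legal moves
agrees there with the value. -/
theorem IsBellman.eq_of_verification (hv : IsBellman G γ ε m v) (hγ₀ : 0 ≤ γ) (hγ₁ : γ < 1)
    {A : Set (State V c)} {U : State V c → ℝ} {μ : State V c → V}
    (hA : ∀ s ∈ A, ¬ s.IsCapture → ∀ w, s.Legal G w → s.next w ∈ A)
    (hU : ∀ s, s.IsCapture → U s = reward ε m s)
    (hμ : ∀ s : State V c, s.Legal G (μ s))
    (hUμ : ∀ s ∈ A, ¬ s.IsCapture → U s = γ * U (s.next (μ s)))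
    (hle : ∀ s ∈ A, ¬ s.IsCapture → s.mover = m → ∀ w, s.Legal G w → γ * U (s.next w) ≤ U s)
    (hge : ∀ s ∈ A, ¬ s.IsCapture → s.mover ≠ m → ∀ w, s.Legal G w → U s ≤ γ * U (s.next w)) :
    ∀ s ∈ A, v s = U s := by
  intro s hsA
  refine le_antisymm ?_ ?_
  · refine le_of_contraction (A := A) hγ₁ (fun s hA' => ?_) hγ₀ s hsA
    by_cases hs : s.IsCapture
    · exact Or.inl (by rw [hv.capture s hs, hU s hs])
    right
    by_cases hm : s.mover = m
    · obtain ⟨w, hw, h⟩ := hv.greedy s hs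
      exact ⟨_, hA s hA' hs w hw, by linarith [hle s hA' hs hm w hw]⟩
    · exact ⟨_, hA s hA' hs _ (hμ s), by
        linarith [hv.self_le s hs hm _ (hμ s), hUμ s hA' hs]⟩
  · refine le_of_contraction (A := A) hγ₁ (fun s hA' => ?_) hγ₀ s hsA
    by_cases hs : s.IsCapture
    · exact Or.inl (by rw [hv.capture s hs, hU s hs])
    right
    by_cases hm : s.mover = m
    · exact ⟨_, hA s hA' hs _ (hμ s), by
        linarith [hv.le_self s hs hm _ (hμ s), hUμ s hA' hs]⟩
    · obtain ⟨w, hw, h⟩ := hv.greedy s hs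
      exact ⟨_, hA s hA' hs w hw, by linarith [hge s hA' hs hm w hw]⟩

end Payoff

/-! ### Coordinates on the path and one-sided states -/

/-- `x` numbers the vertices of the path `G` consecutively from one end to the other. -/
structure IsPathCoord (G : SimpleGraph V) (x : V → ℕ) : Prop where
  inj : Function.Injective x
  adj_iff : ∀ u v, G.Adj u v ↔ x u + 1 = x v ∨ x v + 1 = x u
  exists_pred : ∀ u, 0 < x u → ∃ v, x v + 1 = x u
  exists_succ : ∀ u v, x u < x v → ∃ w, x w = x u + 1

theorem isPathCoord_val {k : ℕ} {G : SimpleGraph V} (e : G ≃g SimpleGraph.pathGraph k) :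
    IsPathCoord G fun u => (e u).val where
  inj u v h := e.injective (Fin.ext h)
  adj_iff u v := by rw [← e.map_adj_iff, SimpleGraph.pathGraph_adj]
  exists_pred u h := ⟨e.symm ⟨(e u).val - 1, by omega⟩, by simp; omega⟩
  exists_succ u v h := ⟨e.symm ⟨(e u).val + 1, by omega⟩, by simp⟩

/-- The reflected coordinate lets cops below the robber be treated as cops above him. -/
theorem isPathCoord_rev {k : ℕ} {G : SimpleGraph V} (e : G ≃g SimpleGraph.pathGraph k) :
    IsPathCoord G fun u => k - 1 - (e u).val where
  inj u v h := e.injective (Fin.ext (by simp only at h; omega))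
  adj_iff u v := by
    rw [← e.map_adj_iff, SimpleGraph.pathGraph_adj]
    omega
  exists_pred u h := ⟨e.symm ⟨(e u).val + 1, by omega⟩, by simp; omega⟩
  exists_succ u v h := ⟨e.symm ⟨(e u).val - 1, by omega⟩, by simp; omega⟩

theorem IsPathCoord.legal_iff {G : SimpleGraph V} {x : V → ℕ} (hx : IsPathCoord G x)
    (s : State V c) (w : V) : s.Legal G w ↔
      x w = x (s.pos s.mover) ∨ x (s.pos s.mover) + 1 = x w ∨ x w + 1 = x (s.pos s.mover) := by
  rw [State.Legal, hx.adj_iff, hx.inj.eq_iff]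

theorem IsPathCoord.isCapture_iff {G : SimpleGraph V} {x : V → ℕ} (hx : IsPathCoord G x)
    (s : State V c) : s.IsCapture ↔ ∃ i : Fin c, x (s.pos i.castSucc) = x (s.pos (Fin.last c)) := by
  simp only [State.IsCapture, hx.inj.eq_iff]

/-- All cops have larger coordinates than the robber. -/
def State.DownSided (x : V → ℕ) (s : State V c) : Prop :=
  ∀ i : Fin c, x (s.pos (Fin.last c)) < x (s.pos i.castSucc)

theorem State.DownSided.not_isCapture {x : V → ℕ} {s : State V c} (h : s.DownSided x) :
    ¬ s.IsCapture := by
  rintro ⟨i, hi⟩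
  exact absurd (congrArg x hi) (h i).ne'

section Next

theorem State.next_pos_of_mover {s : State V c} {k : Fin (c + 1)} (h : s.mover = k) (w : V) :
    (s.next w).pos k = w := by
  subst h
  exact Function.update_self ..

theorem State.next_pos_of_ne {s : State V c} {k : Fin (c + 1)} (h : s.mover ≠ k) (w : V) :
    (s.next w).pos k = s.pos k :=
  Function.update_of_ne h.symm ..

theorem State.next_mover_val_last {s : State V c} (h : s.mover = Fin.last c) (w : V) :
    (s.next w).mover.val = 0 := by
  simp [State.next, h]

theorem State.next_mover_val_castSucc {s : State V c} {i : Fin c} (h : s.mover = i.castSucc)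
    (w : V) : (s.next w).mover.val = i.val + 1 := by
  simp [State.next, h]

theorem mover_cases (s : State V c) : s.mover = Fin.last c ∨ ∃ i : Fin c, s.mover = i.castSucc := by
  rcases Fin.eq_castSucc_or_eq_last s.mover with ⟨i, h⟩ | h
  · exact Or.inr ⟨i, h⟩
  · exact Or.inl h

theorem last_ne_castSucc (i : Fin c) : Fin.last c ≠ i.castSucc := (Fin.castSucc_ne_last i).symm

end Next

/-- One token moves at a time, by at most one step, so a cop and the robber cannot pass each other
without meeting. -/
theorem State.DownSided.next {G : SimpleGraph V} {x : V → ℕ} (hx : IsPathCoord G x)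
    {s : State V c} (h : s.DownSided x) {w : V} (hw : s.Legal G w) :
    (s.next w).IsCapture ∨ (s.next w).DownSided x := by
  by_contra! hcon
  obtain ⟨h1, h2⟩ := hcon
  refine h2 fun i => ?_
  have h3 : x ((s.next w).pos i.castSucc) ≠ x ((s.next w).pos (Fin.last c)) :=
    fun h => h1 ((hx.isCapture_iff _).2 ⟨i, h⟩)
  have h4 := h i
  rw [hx.legal_iff] at hw
  rcases mover_cases s with hm | ⟨j, hm⟩
  · rw [State.next_pos_of_mover hm, State.next_pos_of_ne (hm ▸ last_ne_castSucc i)] at *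
    rw [hm] at hw
    omega
  · rw [State.next_pos_of_ne (k := Fin.last c) (hm ▸ Fin.castSucc_ne_last j)] at *
    by_cases hij : j = i
    · subst hij
      rw [State.next_pos_of_mover hm] at *
      rw [hm] at hw
      omega
    · rw [State.next_pos_of_ne (hm ▸ by simpa using hij)] at *
      omega

/-! ### Catch times when the robber runs to coordinate `0` -/

/-- The number of turns until cop `i` has made his next move. -/
def delay (s : State V c) (i : Fin c) : ℕ :=
  if s.mover.val ≤ i.val then i.val - s.mover.val + 1 else i.val + (c + 2) - s.mover.val

/-- The number of further rounds that cop `i` needs to catch a robber who runs to the vertex with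
coordinate `0`. -/
def rounds (x : V → ℕ) (s : State V c) (i : Fin c) : ℕ :=
  -- An adjacent cop who moves before the robber catches him at once. Any other cop cannot close the
  -- gap while the robber runs, so he catches only at coordinate `0`, which takes as many moves as
  -- his own coordinate; the first of them is counted in `delay`.
  if s.mover.val ≤ i.val ∧ x (s.pos i.castSucc) = x (s.pos (Fin.last c)) + 1 then 0
  else x (s.pos i.castSucc) - 1

/-- The number of turns that cop `i` needs to catch a robber who runs to the vertex with
coordinate `0`, if no other cop does so before. -/
def catchTime (x : V → ℕ) (s : State V c) (i : Fin c) : ℕ :=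
  delay s i + (c + 1) * rounds x s i

theorem one_le_delay (s : State V c) (i : Fin c) : 1 ≤ delay s i := by
  have := s.mover.isLt
  unfold delay
  split_ifs <;> omega

theorem delay_le (s : State V c) (i : Fin c) : delay s i ≤ c + 1 := by
  have := s.mover.isLt
  have := i.isLt
  unfold delay
  split_ifs <;> omega

theorem delay_injective (s : State V c) : Function.Injective (delay s) := by
  intro i j h
  have := s.mover.isLt
  have := i.isLt
  have := j.isLt
  unfold delay at h
  ext
  split_ifs at h <;> omega

theorem one_le_catchTime (x : V → ℕ) (s : State V c) (i : Fin c) : 1 ≤ catchTime x s i :=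
  (one_le_delay s i).trans (Nat.le_add_right _ _)

/-- Delays are distinct and lie between `1` and `c + 1`, so the catch time modulo `c + 1` already
identifies the cop. This makes the first catcher unique. -/
theorem catchTime_injective (x : V → ℕ) (s : State V c) : Function.Injective (catchTime x s) := by
  intro i j h
  apply delay_injective s
  have h1 := one_le_delay s i
  have h2 := one_le_delay s j
  have h3 := delay_le s i
  have h4 := delay_le s j
  unfold catchTime at h
  have key : (delay s i - 1) % (c + 1) = (delay s j - 1) % (c + 1) := by
    rw [← Nat.add_mul_mod_self_left (delay s i - 1) (c + 1) (rounds x s i),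
      ← Nat.add_mul_mod_self_left (delay s j - 1) (c + 1) (rounds x s j)]
    congr 1
    omega
  rw [Nat.mod_eq_of_lt (by omega), Nat.mod_eq_of_lt (by omega)] at key
  omega

/-- Delays vary by less than a full round of `c + 1` turns, so catch times are ordered first by
rounds and only then by delay. -/
theorem rounds_le_of_catchTime_le {x : V → ℕ} {s : State V c} {i j : Fin c}
    (h : catchTime x s i ≤ catchTime x s j) : rounds x s i ≤ rounds x s j := by
  by_contra! hlt
  have h2 := Nat.mul_le_mul_left (c + 1) (Nat.succ_le_of_lt hlt)
  have h3 := delay_le s j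
  have h4 := one_le_delay s i
  unfold catchTime at h
  rw [Nat.succ_eq_add_one, mul_add] at h2
  omega

section Step

variable {G : SimpleGraph V} {x : V → ℕ} {s : State V c} {w : V}

theorem catchTime_next_of_mover_ne {i j : Fin c} (hm : s.mover = j.castSucc) (hij : j ≠ i) :
    catchTime x (s.next w) i + 1 = catchTime x s i := by
  have hij' : j.val ≠ i.val := fun h => hij (Fin.ext h)
  have := j.isLt
  have := i.isLt
  have h1 : delay (s.next w) i + 1 = delay s i := by
    unfold delay
    rw [State.next_mover_val_castSucc hm, hm]
    simp only [Fin.val_castSucc]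
    split_ifs <;> omega
  have h2 : rounds x (s.next w) i = rounds x s i := by
    unfold rounds
    rw [State.next_mover_val_castSucc hm,
      State.next_pos_of_ne (k := Fin.last c) (hm ▸ Fin.castSucc_ne_last j),
      State.next_pos_of_ne (hm ▸ by simpa using hij), hm]
    simp only [Fin.val_castSucc]
    congr 1
    simp only [eq_iff_iff]
    omega
  unfold catchTime
  rw [h2]
  omega

theorem catchTime_of_mover {i : Fin c} (hm : s.mover = i.castSucc) :
    catchTime x s i = 1 + (c + 1) * (if x (s.pos i.castSucc) = x (s.pos (Fin.last c)) + 1 then 0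
      else x (s.pos i.castSucc) - 1) := by
  simp [catchTime, delay, rounds, hm]

theorem catchTime_next_of_mover {i : Fin c} (hm : s.mover = i.castSucc) :
    catchTime x (s.next w) i = (c + 1) * (x w - 1 + 1) := by
  have := i.isLt
  have h1 : delay (s.next w) i = c + 1 := by
    unfold delay
    rw [State.next_mover_val_castSucc hm, if_neg (by omega)]
    omega
  have h2 : rounds x (s.next w) i = x w - 1 := by
    unfold rounds
    rw [State.next_mover_val_castSucc hm, State.next_pos_of_mover hm, if_neg (by omega)]
  rw [catchTime, h1, h2]
  ring

theorem catchTime_next_of_mover_toward {i : Fin c} (hm : s.mover = i.castSucc)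
    (hs' : (s.next w).DownSided x) (hw : x w + 1 = x (s.pos i.castSucc)) :
    catchTime x (s.next w) i + 1 = catchTime x s i := by
  have h1 := hs' i
  rw [State.next_pos_of_mover hm, State.next_pos_of_ne (hm ▸ Fin.castSucc_ne_last i)] at h1
  rw [catchTime_next_of_mover hm, catchTime_of_mover hm, if_neg (by omega), ← hw,
    Nat.sub_add_cancel (by omega), Nat.add_sub_cancel]
  ring

theorem catchTime_le_next_of_mover (hx : IsPathCoord G x) {i : Fin c} (hm : s.mover = i.castSucc)
    (hs : s.DownSided x) (hw : s.Legal G w) :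
    catchTime x s i ≤ catchTime x (s.next w) i + 1 := by
  have h1 := hs i
  rw [hx.legal_iff, hm] at hw
  rw [catchTime_next_of_mover hm, catchTime_of_mover hm, add_comm 1]
  refine Nat.add_le_add_right (Nat.mul_le_mul_left _ ?_) 1
  split_ifs <;> omega

theorem catchTime_eq_one_of_isCapture (hx : IsPathCoord G x) {i : Fin c}
    (hm : s.mover = i.castSucc) (hs : s.DownSided x) (hw : s.Legal G w)
    (hc : (s.next w).IsCapture) :
    w = s.pos (Fin.last c) ∧ catchTime x s i = 1 := by
  obtain ⟨j, hj⟩ := hc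
  rw [State.next_pos_of_ne (k := Fin.last c) (hm ▸ Fin.castSucc_ne_last i)] at hj
  by_cases hij : i = j
  · subst hij
    rw [State.next_pos_of_mover hm] at hj
    subst hj
    have h1 := hs i
    rw [hx.legal_iff, hm] at hw
    rw [catchTime_of_mover hm, if_pos (by omega)]
    simp
  · rw [State.next_pos_of_ne (hm ▸ by simpa using hij)] at hj
    exact absurd ⟨j, hj⟩ hs.not_isCapture

theorem catchTime_of_last {i : Fin c} (hm : s.mover = Fin.last c) :
    catchTime x s i = i.val + 2 + (c + 1) * (x (s.pos i.castSucc) - 1) := by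
  have := i.isLt
  have h1 : ¬ c ≤ i.val := by omega
  simp only [catchTime, delay, rounds, hm, Fin.val_last, h1, false_and, if_false]
  omega

theorem catchTime_next_of_last {i : Fin c} (hm : s.mover = Fin.last c) :
    catchTime x (s.next w) i = i.val + 1 + (c + 1) *
      (if x (s.pos i.castSucc) = x w + 1 then 0 else x (s.pos i.castSucc) - 1) := by
  simp only [catchTime, delay, rounds, State.next_mover_val_last hm, Nat.zero_le, true_and,
    if_true, State.next_pos_of_mover hm, State.next_pos_of_ne (hm ▸ last_ne_castSucc i)]
  rfl

theorem catchTime_next_of_last_le {i : Fin c} (hm : s.mover = Fin.last c) :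
    catchTime x (s.next w) i + 1 ≤ catchTime x s i := by
  rw [catchTime_of_last hm, catchTime_next_of_last hm, add_right_comm]
  refine Nat.add_le_add_left (Nat.mul_le_mul_left _ ?_) _
  split_ifs <;> omega

theorem catchTime_next_of_last_away {i : Fin c} (hm : s.mover = Fin.last c) (hs : s.DownSided x)
    (hw : x w = x (s.pos s.mover) - 1) :
    catchTime x (s.next w) i + 1 = catchTime x s i := by
  have h1 := hs i
  rw [hm] at hw
  rw [catchTime_of_last hm, catchTime_next_of_last hm, add_right_comm]
  congr 2
  split_ifs <;> omega

/-- On the robber's turn `rounds` is the coordinate minus one for every cop, so the first catcher is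
among the cops nearest to the robber. If the robber can step onto any cop, the first catcher stands
there too and shares the reward. -/
theorem next_pos_eq_of_isCapture (hx : IsPathCoord G x) {i : Fin c} (hm : s.mover = Fin.last c)
    (hs : s.DownSided x) (hw : s.Legal G w) (hc : (s.next w).IsCapture)
    (hi : ∀ j, catchTime x s i ≤ catchTime x s j) :
    (s.next w).pos i.castSucc = (s.next w).pos (Fin.last c) := by
  obtain ⟨j, hj⟩ := hc
  rw [State.next_pos_of_mover hm, State.next_pos_of_ne (hm ▸ last_ne_castSucc _)] at *
  subst hj
  apply hx.inj
  have h1 := rounds_le_of_catchTime_le (hi j)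
  have h2 := hs i
  have h3 := hs j
  rw [hx.legal_iff, hm] at hw
  have h4 : ∀ k : Fin c, ¬ c ≤ k.val := fun k => by omega
  simp only [rounds, hm, Fin.val_last, h4, false_and, if_false] at h1
  omega

end Step

/-! ### Rewards at a capture when `ε = 0` -/

section Reward

theorem captors_pos {s : State V c} (hs : s.IsCapture) : 1 ≤ s.captors := by
  obtain ⟨i, hi⟩ := hs
  have : Nonempty {i : Fin c // s.pos i.castSucc = s.pos (Fin.last c)} := ⟨⟨i, hi⟩⟩
  exact Nat.card_pos

theorem captors_le (s : State V c) : s.captors ≤ c :=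
  (Finite.card_subtype_le _).trans (by simp)

theorem captors_eq_iff (s : State V c) :
    s.captors = c ↔ ∀ i : Fin c, s.pos i.castSucc = s.pos (Fin.last c) := by
  classical
  rw [State.captors, Nat.card_eq_fintype_card]
  conv_lhs => rhs; rw [← Fintype.card_fin c]
  constructor
  · intro h i
    by_contra hi
    exact (Fintype.card_subtype_lt (p := fun i : Fin c => s.pos i.castSucc = s.pos (Fin.last c))
      hi).ne h
  · intro h
    exact Fintype.card_congr (Equiv.subtypeUnivEquiv h)

theorem reward_last (ε : ℝ) (s : State V c) : reward ε (Fin.last c) s = -1 := by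
  simp [reward]

theorem reward_of_pos_ne {s : State V c} {i : Fin c}
    (h : s.pos i.castSucc ≠ s.pos (Fin.last c)) : reward 0 i.castSucc s = 0 := by
  have h1 : s.captors ≠ c := fun h' => h ((captors_eq_iff s).1 h' i)
  simp [reward, h, h1, Fin.castSucc_ne_last]

theorem reward_of_pos_eq {s : State V c} {i : Fin c}
    (h : s.pos i.castSucc = s.pos (Fin.last c)) : reward 0 i.castSucc s = 1 / s.captors := by
  by_cases h1 : s.captors = c <;> simp [reward, h, h1, Fin.castSucc_ne_last]

theorem reward_castSucc_nonneg (s : State V c) (i : Fin c) : 0 ≤ reward 0 i.castSucc s := by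
  by_cases h : s.pos i.castSucc = s.pos (Fin.last c)
  · rw [reward_of_pos_eq h]
    positivity
  · rw [reward_of_pos_ne h]

theorem reward_castSucc_le {s : State V c} (hs : s.IsCapture) (i : Fin c) :
    reward 0 i.castSucc s ≤ 1 := by
  by_cases h : s.pos i.castSucc = s.pos (Fin.last c)
  · rw [reward_of_pos_eq h, div_le_one (by exact_mod_cast captors_pos hs)]
    exact_mod_cast captors_pos hs
  · rw [reward_of_pos_ne h]
    exact zero_le_one

theorem le_reward_of_pos_eq {s : State V c} {i : Fin c}
    (h : s.pos i.castSucc = s.pos (Fin.last c)) : 1 / (c : ℝ) ≤ reward 0 i.castSucc s := by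
  rw [reward_of_pos_eq h]
  have h1 := captors_pos ⟨i, h⟩
  exact one_div_le_one_div_of_le (by exact_mod_cast h1) (by exact_mod_cast captors_le s)

/-- A cop who moves to the robber is his only captor. -/
theorem reward_next_of_mover {s : State V c} (hs : ¬ s.IsCapture) {i : Fin c}
    (hm : s.mover = i.castSucc) :
    reward 0 i.castSucc (s.next (s.pos (Fin.last c))) = 1 := by
  have h0 : (s.next (s.pos (Fin.last c))).pos (Fin.last c) = s.pos (Fin.last c) :=
    State.next_pos_of_ne (hm ▸ Fin.castSucc_ne_last i) _
  have h1 : (s.next (s.pos (Fin.last c))).pos i.castSucc =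
      (s.next (s.pos (Fin.last c))).pos (Fin.last c) := by
    rw [State.next_pos_of_mover hm, h0]
  have h2 : (s.next (s.pos (Fin.last c))).captors = 1 := by
    rw [State.captors, Nat.card_eq_one_iff_exists]
    refine ⟨⟨i, h1⟩, fun ⟨j, hj⟩ => Subtype.ext ?_⟩
    by_contra hij
    rw [h0, State.next_pos_of_ne (hm ▸ by simpa using Ne.symm hij)] at hj
    exact hs ⟨j, hj⟩
  rw [reward_of_pos_eq h1, h2]
  simp

end Reward

/-! ### Moving towards coordinate `0` is optimal in every game -/

section Toward

variable {G : SimpleGraph V} {x : V → ℕ} {s : State V c} {w : V}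

theorem catchTime_next_toward (hs : s.DownSided x) (hs' : (s.next w).DownSided x)
    (hw : x w = x (s.pos s.mover) - 1) (i : Fin c) :
    catchTime x (s.next w) i + 1 = catchTime x s i := by
  rcases mover_cases s with hm | ⟨j, hm⟩
  · exact catchTime_next_of_last_away hm hs hw
  · by_cases hij : j = i
    · subst hij
      have := hs j
      rw [hm] at hw
      exact catchTime_next_of_mover_toward hm hs' (by omega)
    · exact catchTime_next_of_mover_ne hm hij

/-- No move of a cop speeds up a catch: a turn shortens a catch time by at most the turn itself. -/
theorem catchTime_le_next (hx : IsPathCoord G x) {j : Fin c} (hm : s.mover = j.castSucc)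
    (hs : s.DownSided x) (hw : s.Legal G w) (i : Fin c) :
    catchTime x s i ≤ catchTime x (s.next w) i + 1 := by
  by_cases hij : j = i
  · subst hij
    exact catchTime_le_next_of_mover hx hm hs hw
  · exact (catchTime_next_of_mover_ne hm hij).ge

theorem IsPathCoord.exists_toward (hx : IsPathCoord G x) :
    ∃ μ : V → V, ∀ u, x (μ u) = x u - 1 := by
  have : ∀ u, ∃ w, x w = x u - 1 := by
    intro u
    rcases Nat.eq_zero_or_pos (x u) with h | h
    · exact ⟨u, by omega⟩
    · obtain ⟨w, hw⟩ := hx.exists_pred u h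
      exact ⟨w, by omega⟩
  choose μ hμ using this
  exact ⟨μ, hμ⟩

theorem IsPathCoord.legal_toward (hx : IsPathCoord G x) (hw : x w = x (s.pos s.mover) - 1) :
    s.Legal G w := by
  rw [hx.legal_iff]
  omega

/-- The capture time if everybody moves towards the vertex with coordinate `0`. -/
noncomputable def firstCatch (x : V → ℕ) (s : State V c) : ℕ :=
  ⨅ i, catchTime x s i

theorem firstCatch_le (x : V → ℕ) (s : State V c) (i : Fin c) :
    firstCatch x s ≤ catchTime x s i :=
  ciInf_le (OrderBot.bddBelow _) i

theorem exists_catchTime_eq_firstCatch [Nonempty (Fin c)] (x : V → ℕ) (s : State V c) :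
    ∃ i, catchTime x s i = firstCatch x s :=
  Nat.sInf_mem (Set.range_nonempty _)

/-- Cop `i` is the first to catch a robber who runs to the vertex with coordinate `0`. -/
def IsLeader (x : V → ℕ) (s : State V c) (i : Fin c) : Prop :=
  ∀ j, catchTime x s i ≤ catchTime x s j

theorem isLeader_of_catchTime_eq_one {i : Fin c} (h : catchTime x s i = 1) : IsLeader x s i :=
  fun j => h.trans_le (one_le_catchTime x s j)

theorem IsLeader.unique {i j : Fin c} (hi : IsLeader x s i) (hj : IsLeader x s j) : i = j :=
  catchTime_injective x s (le_antisymm (hi j) (hj i))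

theorem isLeader_next_iff {i : Fin c} (h : ∀ j, catchTime x (s.next w) j + 1 = catchTime x s j) :
    IsLeader x (s.next w) i ↔ IsLeader x s i := by
  simp only [IsLeader, ← h, Nat.add_le_add_iff_right]

/-- In the `DownSided` states, moving towards coordinate `0` is optimal in the modified cops and
robber game. -/
theorem IsBellman.greedy_last [Finite V] [Nonempty (Fin c)] {γ : ℝ} {v : State V c → ℝ}
    (hv : IsBellman G γ 0 (Fin.last c) v) (hγ₀ : 0 < γ) (hγ₁ : γ < 1) (hx : IsPathCoord G x)
    (hs : s.DownSided x) (hw : x w = x (s.pos s.mover) - 1) :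
    v s = γ * v (s.next w) := by
  classical
  obtain ⟨μ, hμ⟩ := hx.exists_toward
  -- The candidate value. It is verified on captures together with `DownSided` states, a set closed
  -- under legal moves: the robber cannot delay the first catch and no cop can hasten it.
  let U : State V c → ℝ := fun s => if s.IsCapture then -1 else -γ ^ firstCatch x s
  have hUc : ∀ s : State V c, s.IsCapture → U s = -1 := fun s h => if_pos h
  have hUn : ∀ s : State V c, ¬ s.IsCapture → U s = -γ ^ firstCatch x s := fun s h => if_neg h
  have hpow : ∀ {a b : ℕ}, a ≤ b + 1 → γ * γ ^ b ≤ γ ^ a := fun {a b} h => by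
    rw [← pow_succ']
    exact pow_le_pow_of_le_one hγ₀.le hγ₁.le h
  have hpow' : ∀ {a b : ℕ}, b + 1 ≤ a → γ ^ a ≤ γ * γ ^ b := fun {a b} h => by
    rw [← pow_succ']
    exact pow_le_pow_of_le_one hγ₀.le hγ₁.le h
  have hone : ∀ s : State V c, 1 ≤ firstCatch x s := fun s => by
    obtain ⟨i, hi⟩ := exists_catchTime_eq_firstCatch x s
    exact hi ▸ one_le_catchTime x s i
  have hcop : ∀ (s : State V c) (w : V) (i : Fin c), s.DownSided x → s.mover = i.castSucc →
      s.Legal G w → (s.next w).IsCapture → firstCatch x s = 1 := fun s w i hs hm hw hc =>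
    le_antisymm ((firstCatch_le x s i).trans
      (catchTime_eq_one_of_isCapture hx hm hs hw hc).2.le) (hone s)
  have hrob : ∀ (s : State V c) (w : V), s.DownSided x → s.mover = Fin.last c →
      s.Legal G w → γ * U (s.next w) ≤ U s := by
    intro s w hs hm hw
    rw [hUn s hs.not_isCapture]
    by_cases hc : (s.next w).IsCapture
    · rw [hUc _ hc]
      have := pow_le_pow_of_le_one hγ₀.le hγ₁.le (hone s)
      linarith
    · rw [hUn _ hc]
      obtain ⟨i, hi⟩ := exists_catchTime_eq_firstCatch x s
      have h1 := catchTime_next_of_last_le (x := x) (w := w) (i := i) hm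
      have h2 := firstCatch_le x (s.next w) i
      have := hpow' (a := firstCatch x s) (b := firstCatch x (s.next w)) (by omega)
      linarith
  have hcops : ∀ (s : State V c) (w : V), s.DownSided x → s.mover ≠ Fin.last c →
      s.Legal G w → U s ≤ γ * U (s.next w) := by
    intro s w hs hm hw
    obtain ⟨j, hm⟩ := (mover_cases s).resolve_left hm
    rw [hUn s hs.not_isCapture]
    by_cases hc : (s.next w).IsCapture
    · rw [hUc _ hc, hcop s w j hs hm hw hc]
      linarith
    · rw [hUn _ hc]
      obtain ⟨i, hi⟩ := exists_catchTime_eq_firstCatch x (s.next w)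
      have h1 := catchTime_le_next hx hm hs hw i
      have h2 := firstCatch_le x s i
      have := hpow (a := firstCatch x s) (b := firstCatch x (s.next w)) (by omega)
      linarith
  have htow : ∀ (s : State V c) (w : V), s.DownSided x → x w = x (s.pos s.mover) - 1 →
      U s = γ * U (s.next w) := by
    intro s w hs hw
    have hleg : s.Legal G w := hx.legal_toward hw
    rw [hUn s hs.not_isCapture]
    rcases hs.next hx hleg with hc | hs'
    · rw [hUc _ hc]
      rcases mover_cases s with hm | ⟨j, hm⟩
      · obtain ⟨i, hi⟩ := (hx.isCapture_iff _).1 hc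
        rw [State.next_pos_of_mover hm, State.next_pos_of_ne (hm ▸ last_ne_castSucc _)] at hi
        have := hs i
        rw [hm] at hw
        omega
      · rw [hcop s w j hs hm hleg hc]
        ring
    · rw [hUn _ hs'.not_isCapture]
      have key := catchTime_next_toward hs hs' hw
      obtain ⟨i, hi⟩ := exists_catchTime_eq_firstCatch x s
      obtain ⟨j, hj⟩ := exists_catchTime_eq_firstCatch x (s.next w)
      have h1 := firstCatch_le x (s.next w) i
      have h2 := firstCatch_le x s j
      have h3 := key i
      have h4 := key j
      rw [show firstCatch x s = firstCatch x (s.next w) + 1 by omega]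
      ring
  have hA : ∀ s : State V c, s ∈ {s : State V c | s.IsCapture ∨ s.DownSided x} →
      ¬ s.IsCapture → s.DownSided x := fun s h hc => h.resolve_left hc
  have key := hv.eq_of_verification (A := {s | s.IsCapture ∨ s.DownSided x}) (U := U)
    (μ := fun s => μ (s.pos s.mover)) hγ₀.le hγ₁
    (fun s h hc w hw => (hA s h hc).next hx hw)
    (fun s h => by rw [hUc s h, reward_last])
    (fun s => hx.legal_toward (hμ _))
    (fun s h hc => htow s _ (hA s h hc) (hμ _))
    (fun s h hc hm w hw => hrob s w (hA s h hc) hm hw)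
    (fun s h hc hm w hw => hcops s w (hA s h hc) hm hw)
  rw [key s (Or.inr hs), key _ (hs.next hx (hx.legal_toward hw))]
  exact htow s w hs hw

/-- In the `DownSided` states, moving towards coordinate `0` is optimal in the game `Γ^k` of any
cop `k`, if the discount factor is at most `1 / c`. -/
theorem IsBellman.greedy_castSucc [Finite V] {γ : ℝ} {v : State V c → ℝ} {k : Fin c}
    (hv : IsBellman G γ 0 k.castSucc v) (hγ₀ : 0 < γ) (hγ₁ : γ < 1) (hγc : γ ≤ 1 / c)
    (hx : IsPathCoord G x) (hs : s.DownSided x) (hw : x w = x (s.pos s.mover) - 1) :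
    v s = γ * v (s.next w) := by
  classical
  obtain ⟨μ, hμ⟩ := hx.exists_toward
  -- Since the leader captures alone when all move towards `0`, he receives the full reward `1`;
  -- every other cop can be held to `0`.
  let U : State V c → ℝ := fun s => if s.IsCapture then reward 0 k.castSucc s
    else if IsLeader x s k then γ ^ catchTime x s k else 0
  have hUc : ∀ s : State V c, s.IsCapture → U s = reward 0 k.castSucc s := fun s h => if_pos h
  have hUl : ∀ s : State V c, ¬ s.IsCapture → IsLeader x s k → U s = γ ^ catchTime x s k :=
    fun s h h' => by simp only [U, h, h', if_true, if_false]
  have hUn : ∀ s : State V c, ¬ s.IsCapture → ¬ IsLeader x s k → U s = 0 :=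
    fun s h h' => by simp only [U, h, h', if_false]
  have hU0 : ∀ s, 0 ≤ U s := by
    intro s
    simp only [U]
    split_ifs
    · exact reward_castSucc_nonneg s k
    · positivity
    · exact le_rfl
  have hUle : ∀ s, ¬ s.IsCapture → U s ≤ γ ^ catchTime x s k := by
    intro s hs
    by_cases h : IsLeader x s k
    · exact (hUl s hs h).le
    · rw [hUn s hs h]
      positivity
  have hpow : ∀ {a b : ℕ}, a ≤ b + 1 → γ * γ ^ b ≤ γ ^ a := fun {a b} h => by
    rw [← pow_succ']
    exact pow_le_pow_of_le_one hγ₀.le hγ₁.le h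
  have hpow' : ∀ {a b : ℕ}, b + 1 ≤ a → γ ^ a ≤ γ * γ ^ b := fun {a b} h => by
    rw [← pow_succ']
    exact pow_le_pow_of_le_one hγ₀.le hγ₁.le h
  have hself : ∀ (s : State V c) (w : V), s.DownSided x → s.mover = k.castSucc →
      s.Legal G w → γ * U (s.next w) ≤ U s := by
    intro s w hs hm hw
    by_cases hl : IsLeader x s k
    · rw [hUl s hs.not_isCapture hl]
      by_cases hc : (s.next w).IsCapture
      · rw [(catchTime_eq_one_of_isCapture hx hm hs hw hc).2, hUc _ hc, pow_one]
        exact mul_le_of_le_one_right hγ₀.le (reward_castSucc_le hc k)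
      · exact (mul_le_mul_of_nonneg_left (hUle _ hc) hγ₀.le).trans
          (hpow (catchTime_le_next hx hm hs hw k))
    · have hc : ¬ (s.next w).IsCapture := fun hc =>
        hl (isLeader_of_catchTime_eq_one (catchTime_eq_one_of_isCapture hx hm hs hw hc).2)
      have hl' : ¬ IsLeader x (s.next w) k := by
        -- Cop `k` cannot become leader by his own move: his catch time drops by at most one, that
        -- of every other cop by exactly one.
        refine fun hl' => hl fun j => ?_
        by_cases hj : k = j
        · rw [hj]
        · have h1 := hl' j
          have h2 := catchTime_le_next hx hm hs hw k
          have h3 := catchTime_next_of_mover_ne (x := x) (w := w) hm hj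
          omega
      rw [hUn _ hc hl', mul_zero]
      exact hU0 s
  have hother : ∀ (s : State V c) (w : V), s.DownSided x → s.mover ≠ k.castSucc →
      s.Legal G w → U s ≤ γ * U (s.next w) := by
    intro s w hs hm hw
    by_cases hl : IsLeader x s k
    · rw [hUl s hs.not_isCapture hl]
      rcases mover_cases s with hm' | ⟨j, hm'⟩
      · have h1 := catchTime_next_of_last_le (x := x) (w := w) (i := k) hm'
        by_cases hc : (s.next w).IsCapture
        · rw [hUc _ hc]
          have h2 := le_reward_of_pos_eq (next_pos_eq_of_isCapture hx hm' hs hw hc hl)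
          have h3 := one_le_catchTime x (s.next w) k
          -- On the robber's turn the catch time is at least `2`, so the leader's value is at most
          -- `γ ^ 2`, whereas a robber who runs into him yields at least `γ * (1 / c)`. This is the
          -- only use of `hγc`.
          calc γ ^ catchTime x s k ≤ γ * γ ^ 1 := hpow' (by omega)
            _ ≤ _ := mul_le_mul_of_nonneg_left (by linarith) hγ₀.le
        · have hl' : IsLeader x (s.next w) k := by
            intro j
            have h2 := hl j
            rw [catchTime_next_of_last hm', catchTime_next_of_last hm']
            have h3 := rounds_le_of_catchTime_le h2
            have h4 : ∀ i : Fin c, ¬ c ≤ i.val := fun i => by omega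
            simp only [rounds, hm', Fin.val_last, h4, false_and, if_false] at h3
            rw [catchTime_of_last hm', catchTime_of_last hm'] at h2
            have h5 := hs k
            have h6 := hs j
            have h7 := h4 j
            have h8 := h4 k
            have h9 : x (s.pos k.castSucc) ≠ x w := fun h => hc <|
              (hx.isCapture_iff _).2 ⟨k, by
                rwa [State.next_pos_of_mover hm', State.next_pos_of_ne (hm' ▸ last_ne_castSucc k)]⟩
            rw [hx.legal_iff, hm'] at hw
            -- The leader has the least coordinate: if he is not adjacent to the robber's new
            -- vertex, no cop is. If he is, the other adjacent cops share his coordinate and are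
            -- ranked by turn order as before, and the rest need a further round.
            by_cases hk : x (s.pos k.castSucc) = x w + 1
            · rw [if_pos hk]
              split_ifs with hj
              · rw [hk, hj] at h2
                omega
              · have : c + 1 ≤ (c + 1) * (x (s.pos j.castSucc) - 1) :=
                  Nat.le_mul_of_pos_right _ (by omega)
                omega
            · rw [if_neg hk, if_neg (by omega)]
              omega
          rw [hUl _ hc hl']
          exact hpow' h1
      · have hjk : j ≠ k := by
          rintro rfl
          exact hm hm'
        have h1 := catchTime_next_of_mover_ne (x := x) (w := w) hm' hjk
        have hc : ¬ (s.next w).IsCapture := fun hc => hjk <| IsLeader.unique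
          (isLeader_of_catchTime_eq_one (catchTime_eq_one_of_isCapture hx hm' hs hw hc).2) hl
        -- Another cop's move cannot overtake `k`, whose catch time drops by exactly one.
        have hl' : IsLeader x (s.next w) k := by
          intro i
          have h2 := hl i
          have h3 := catchTime_le_next hx hm' hs hw i
          omega
        rw [hUl _ hc hl', ← h1, pow_succ']
    · rw [hUn _ hs.not_isCapture hl]
      exact mul_nonneg hγ₀.le (hU0 _)
  have htow : ∀ (s : State V c) (w : V), s.DownSided x → x w = x (s.pos s.mover) - 1 →
      U s = γ * U (s.next w) := by
    intro s w hs hw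
    have hleg : s.Legal G w := hx.legal_toward hw
    rcases hs.next hx hleg with hc | hs'
    · rcases mover_cases s with hm | ⟨j, hm⟩
      · obtain ⟨i, hi⟩ := (hx.isCapture_iff _).1 hc
        rw [State.next_pos_of_mover hm, State.next_pos_of_ne (hm ▸ last_ne_castSucc _)] at hi
        have := hs i
        rw [hm] at hw
        omega
      · obtain ⟨hw', h1⟩ := catchTime_eq_one_of_isCapture hx hm hs hleg hc
        by_cases hjk : j = k
        · subst hjk
          rw [hUl s hs.not_isCapture (isLeader_of_catchTime_eq_one h1), h1, hUc _ hc, hw',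
            reward_next_of_mover hs.not_isCapture hm]
          ring
        · rw [hUn s hs.not_isCapture fun hl => hjk ((isLeader_of_catchTime_eq_one h1).unique hl),
            hUc _ hc, reward_of_pos_ne, mul_zero]
          rw [State.next_pos_of_ne (hm ▸ by simpa using hjk),
            State.next_pos_of_ne (k := Fin.last c) (hm ▸ Fin.castSucc_ne_last j)]
          exact fun h => hs.not_isCapture ⟨k, h⟩
    · have key := catchTime_next_toward hs hs' hw
      by_cases hl : IsLeader x s k
      · rw [hUl s hs.not_isCapture hl, hUl _ hs'.not_isCapture ((isLeader_next_iff key).2 hl),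
          ← key k, pow_succ']
      · rw [hUn s hs.not_isCapture hl,
          hUn _ hs'.not_isCapture (mt (isLeader_next_iff key).1 hl), mul_zero]
  have hA : ∀ s : State V c, s ∈ {s : State V c | s.IsCapture ∨ s.DownSided x} →
      ¬ s.IsCapture → s.DownSided x := fun s h hc => h.resolve_left hc
  have key := hv.eq_of_verification (A := {s | s.IsCapture ∨ s.DownSided x}) (U := U)
    (μ := fun s => μ (s.pos s.mover)) hγ₀.le hγ₁
    (fun s h hc w hw => (hA s h hc).next hx hw)
    hUc
    (fun s => hx.legal_toward (hμ _))
    (fun s h hc => htow s _ (hA s h hc) (hμ _))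
    (fun s h hc hm w hw => hself s w (hA s h hc) hm hw)
    (fun s h hc hm w hw => hother s w (hA s h hc) hm hw)
  rw [key s (Or.inr hs), key _ (hs.next hx (hx.legal_toward hw))]
  exact htow s w hs hw

end Toward

/-! ### Reachable positions -/

/-- The state `s` ends some history from `s₀`. -/
def Reachable (G : SimpleGraph V) (s₀ s : State V c) : Prop :=
  ∃ h, IsHistory G s₀ (s :: h)

theorem Reachable.next {G : SimpleGraph V} {s₀ s : State V c} (h : Reachable G s₀ s)
    (hs : ¬ s.IsCapture) {w : V} (hw : s.Legal G w) : Reachable G s₀ (s.next w) := by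
  obtain ⟨l, hl⟩ := h
  exact ⟨s :: l, .step s l w hl hs hw⟩

/-- The position `p` is not a capture, and can be reached from `s₀` with every token to move. -/
structure ReachablePos (G : SimpleGraph V) (s₀ : State V c) (p : Fin (c + 1) → V) : Prop where
  ne : ∀ i : Fin c, p i.castSucc ≠ p (Fin.last c)
  reachable : ∀ n, Reachable G s₀ ⟨p, n⟩

section Reach

variable {G : SimpleGraph V} {s₀ : State V c} {p : Fin (c + 1) → V}

theorem ReachablePos.not_isCapture (h : ReachablePos G s₀ p) (n : Fin (c + 1)) :
    ¬ (State.mk p n).IsCapture := fun ⟨i, hi⟩ => h.ne i hi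

open scoped Fin.NatCast in
-- Everybody stays put until the desired token has the turn.
theorem Reachable.reachablePos {n : Fin (c + 1)} (h : Reachable G s₀ ⟨p, n⟩)
    (hp : ∀ i : Fin c, p i.castSucc ≠ p (Fin.last c)) : ReachablePos G s₀ p := by
  refine ⟨hp, fun n' => ?_⟩
  have key : ∀ j : ℕ, Reachable G s₀ ⟨p, n + (j : Fin (c + 1))⟩ := by
    intro j
    induction j with
    | zero => simpa using h
    | succ j ih =>
      have := ih.next (fun ⟨i, hi⟩ => hp i hi) (State.legal_stay G _)
      simpa [State.next, add_assoc] using this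
  simpa using key (n' - n).val

theorem ReachablePos.update (h : ReachablePos G s₀ p) {k : Fin (c + 1)} {w : V}
    (hw : G.Adj (p k) w)
    (hne : ∀ i : Fin c, Function.update p k w i.castSucc ≠ Function.update p k w (Fin.last c)) :
    ReachablePos G s₀ (Function.update p k w) :=
  Reachable.reachablePos (n := k + 1)
    ((h.reachable k).next (h.not_isCapture k) (w := w) (Or.inr hw)) hne

theorem ReachablePos.exists_robber_at_zero {x : V → ℕ} (hx : IsPathCoord G x)
    (h : ReachablePos G s₀ p) (hp : ∀ i : Fin c, x (p (Fin.last c)) < x (p i.castSucc)) :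
    ∃ p', ReachablePos G s₀ p' ∧ (∀ i : Fin c, x (p' (Fin.last c)) < x (p' i.castSucc)) ∧
      x (p' (Fin.last c)) = 0 := by
  induction hy : x (p (Fin.last c)) generalizing p with
  | zero => exact ⟨p, h, hp, hy⟩
  | succ y ih =>
    obtain ⟨w, hw⟩ := hx.exists_pred (p (Fin.last c)) (by omega)
    have h1 : ∀ i : Fin c, x (Function.update p (Fin.last c) w (Fin.last c)) <
        x (Function.update p (Fin.last c) w i.castSucc) := by
      intro i
      have := hp i
      rw [Function.update_self, Function.update_of_ne (Fin.castSucc_ne_last i)]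
      omega
    refine ih (h.update ((hx.adj_iff _ _).2 (Or.inr hw)) fun i hi => ?_) h1
      (by rw [Function.update_self]; omega)
    exact (h1 i).ne' (congrArg x hi)

/-- Cops with a gap approach one step at a time while all others stay. The induction is on the sum
of the distances to the robber; each cop remains on his side. -/
theorem ReachablePos.exists_adjacent {x : V → ℕ} (hx : IsPathCoord G x)
    (h : ReachablePos G s₀ p) :
    ∃ p', ReachablePos G s₀ p' ∧ p' (Fin.last c) = p (Fin.last c) ∧ ∀ i : Fin c,
      (x (p (Fin.last c)) < x (p i.castSucc) ∧ x (p' i.castSucc) = x (p (Fin.last c)) + 1) ∨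
      (x (p i.castSucc) < x (p (Fin.last c)) ∧ x (p' i.castSucc) + 1 = x (p (Fin.last c))) := by
  induction hd : ∑ i : Fin c, Nat.dist (x (p i.castSucc)) (x (p (Fin.last c)))
    using Nat.strong_induction_on generalizing p with
  | _ d ih =>
  have hne : ∀ i : Fin c, x (p i.castSucc) ≠ x (p (Fin.last c)) := fun i => hx.inj.ne (h.ne i)
  have step : ∀ (i : Fin c) (w : V), G.Adj (p i.castSucc) w →
      Nat.dist (x w) (x (p (Fin.last c))) < Nat.dist (x (p i.castSucc)) (x (p (Fin.last c))) →
      (x (p i.castSucc) < x (p (Fin.last c)) ∧ x w < x (p (Fin.last c)) ∨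
        x (p (Fin.last c)) < x (p i.castSucc) ∧ x (p (Fin.last c)) < x w) →
      ∃ p', ReachablePos G s₀ p' ∧ p' (Fin.last c) = p (Fin.last c) ∧ ∀ i : Fin c,
      (x (p (Fin.last c)) < x (p i.castSucc) ∧ x (p' i.castSucc) = x (p (Fin.last c)) + 1) ∨
      (x (p i.castSucc) < x (p (Fin.last c)) ∧ x (p' i.castSucc) + 1 = x (p (Fin.last c))) := by
    intro i w hadj hlt hside
    have hlast : Function.update p i.castSucc w (Fin.last c) = p (Fin.last c) :=
      Function.update_of_ne (last_ne_castSucc i) _ _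
    have hother : ∀ j : Fin c, j ≠ i → Function.update p i.castSucc w j.castSucc = p j.castSucc :=
      fun j hj => Function.update_of_ne (by simpa using hj) _ _
    have hself : Function.update p i.castSucc w i.castSucc = w := Function.update_self ..
    have h' : ReachablePos G s₀ (Function.update p i.castSucc w) := by
      refine h.update hadj fun j hj => ?_
      rw [hlast] at hj
      by_cases hij : j = i
      · rw [hij, hself] at hj
        rw [hj] at hside
        omega
      · rw [hother j hij] at hj
        exact h.ne j hj
    obtain ⟨p', h1, h2, h3⟩ := ih _ (by
      rw [← hd, hlast]
      refine Finset.sum_lt_sum (fun j _ => ?_) ⟨i, Finset.mem_univ _, by rwa [hself]⟩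
      by_cases hij : j = i
      · rw [hij, hself]
        exact hlt.le
      · rw [hother j hij]) h' rfl
    rw [hlast] at h2
    refine ⟨p', h1, h2, fun j => ?_⟩
    have h4 := h3 j
    rw [hlast] at h4
    by_cases hij : j = i
    · subst hij
      rw [hself] at h4
      omega
    · rwa [hother j hij] at h4
  by_cases hfar : ∃ i : Fin c, x (p i.castSucc) + 1 < x (p (Fin.last c)) ∨
      x (p (Fin.last c)) + 1 < x (p i.castSucc)
  · obtain ⟨i, hi | hi⟩ := hfar
    · obtain ⟨w, hw⟩ := hx.exists_succ (p i.castSucc) (p (Fin.last c)) (by omega)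
      exact step i w ((hx.adj_iff _ _).2 (Or.inl hw.symm)) (by unfold Nat.dist; omega) (by omega)
    · obtain ⟨w, hw⟩ := hx.exists_pred (p i.castSucc) (by omega)
      exact step i w ((hx.adj_iff _ _).2 (Or.inr hw)) (by unfold Nat.dist; omega) (by omega)
  · push Not at hfar
    refine ⟨p, h, rfl, fun i => ?_⟩
    have := hne i
    have := hfar i
    omega

end Reach

/-! ### Necessity of the two conditions -/

section Necessity

variable {G : SimpleGraph V} {γ : ℝ} {s : State V c}

theorem IsBellman.neg_le_last [Finite V] {v : State V c → ℝ}
    (hv : IsBellman G γ 0 (Fin.last c) v) (hγ₀ : 0 ≤ γ) (hγ₁ : γ < 1) (hs : ¬ s.IsCapture) :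
    -γ ≤ v s := by
  have h1 : ∀ s ∈ Set.univ, -1 ≤ v s :=
    le_of_contraction (γ := γ) hγ₁ (fun s _ => by
      by_cases hs : s.IsCapture
      · exact Or.inl (by rw [hv.capture s hs, reward_last])
      · obtain ⟨w, -, h⟩ := hv.greedy s hs
        exact Or.inr ⟨_, trivial, by linarith⟩) hγ₀
  obtain ⟨w, -, h⟩ := hv.greedy s hs
  nlinarith [h1 (s.next w) trivial]

/-- If the robber cannot move without being caught, the only optimal move in the modified cops
and robber game is to stay. If the same move is optimal in the game of the first cop, who is next
to the robber, then being caught at once gives the first cop at least `γ`. -/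
theorem le_reward_of_common_greedy [Finite V] {z : Fin c} (hz : z.val = 0)
    {v v' : State V c → ℝ} (hv : IsBellman G γ 0 z.castSucc v)
    (hv' : IsBellman G γ 0 (Fin.last c) v') (hγ₀ : 0 < γ) (hγ₁ : γ < 1)
    (hm : s.mover = Fin.last c) (hs : ¬ s.IsCapture)
    (hadj : G.Adj (s.pos (Fin.last c)) (s.pos z.castSucc))
    (hnbr : ∀ u, G.Adj (s.pos (Fin.last c)) u → ∃ i : Fin c, s.pos i.castSucc = u) {w : V}
    (hleg : s.Legal G w) (hw : v s = γ * v (s.next w)) (hw' : v' s = γ * v' (s.next w)) {u : V}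
    (hu : G.Adj (s.pos (Fin.last c)) u) :
    γ ≤ reward 0 z.castSucc (s.next u) := by
  have hcap : ∀ u, G.Adj (s.pos (Fin.last c)) u → (s.next u).IsCapture := by
    intro u hu
    obtain ⟨i, hi⟩ := hnbr u hu
    exact ⟨i, by rw [State.next_pos_of_mover hm,
      State.next_pos_of_ne (hm ▸ last_ne_castSucc i), hi]⟩
  set t := s.next (s.pos s.mover) with ht
  have htpos : t.pos = s.pos := Function.update_eq_self ..
  have htc : ¬ t.IsCapture := by
    rintro ⟨i, hi⟩
    rw [htpos] at hi
    exact hs ⟨i, hi⟩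
  have htm : t.mover = z.castSucc := by
    apply Fin.ext
    rw [ht, State.next_mover_val_last hm, Fin.val_castSucc, hz]
  -- Running into a cop is worth exactly `-γ` to the robber; staying leads to a noncapture state
  -- worth at least `-γ`, hence is itself worth at least `-γ ^ 2`, which is strictly better.
  have hstay : w = s.pos s.mover := by
    refine hleg.resolve_right fun h => ?_
    rw [hm] at h
    rw [hv'.capture _ (hcap w h), reward_last] at hw'
    have h1 := hv'.le_self s hs hm _ (s.legal_stay G)
    have h2 := hv'.neg_le_last hγ₀.le hγ₁ htc
    nlinarith
  -- After the robber stays, the first cop moves next and can capture alone.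
  have h1 : γ ≤ v t := by
    have hleg' : t.Legal G (t.pos (Fin.last c)) := Or.inr (by rw [htm, htpos]; exact hadj.symm)
    have h := hv.le_self t htc htm _ hleg'
    have hcap' : (t.next (t.pos (Fin.last c))).IsCapture :=
      ⟨z, by rw [State.next_pos_of_mover htm,
        State.next_pos_of_ne (s := t) (k := Fin.last c) (htm ▸ Fin.castSucc_ne_last z)]⟩
    rwa [hv.capture _ hcap', reward_next_of_mover htc htm, mul_one] at h
  have h2 := hv.self_le s hs (hm ▸ last_ne_castSucc z) u (Or.inr (hm ▸ hu))
  rw [hv.capture _ (hcap u hu), hw, hstay] at h2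
  exact h1.trans (le_of_mul_le_mul_left h2 hγ₀)

end Necessity

/-- The move prescribed by `φ m` is also that of a CR-optimal strategy, and optimal strategies are
greedy in their own game. -/
theorem exists_common_greedy_of_isPositional {G : SimpleGraph V} {γ : ℝ} [Finite V]
    (hγ₀ : 0 ≤ γ) (hγ₁ : γ < 1) {s₀ : State V c} {v : Fin (c + 1) → State V c → ℝ}
    (hv : ∀ m, IsBellman G γ 0 m (v m)) {φ : Fin (c + 1) → Profile G c}
    (hφ : IsTriggerFamily γ 0 φ) (hpos : IsPositional γ 0 s₀ φ) {s : State V c}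
    (hr : Reachable G s₀ s) (hs : ¬ s.IsCapture) (m : Fin (c + 1)) :
    ∃ w, s.Legal G w ∧ v m s = γ * v m (s.next w) ∧
      v (Fin.last c) s = γ * v (Fin.last c) (s.next w) := by
  obtain ⟨σ, ⟨π, hπ, rfl⟩, h⟩ := hpos s.mover m
  obtain ⟨l, hl⟩ := hr
  have h1 := ((hv m).isOptimal_iff hγ₀ hγ₁ (φ m)).1 (hφ m) s hs
  have h2 := ((hv (Fin.last c)).isOptimal_iff hγ₀ hγ₁ π).1 hπ s hs
  refine ⟨_, (φ m s.mover).legal s rfl, h1, ?_⟩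
  rw [h s l hl rfl hs]
  exact h2

/-- On a path, all cops can be brought next to the robber, who is moreover at the end of the path
if all cops are on one side of him. -/
theorem le_of_common_greedy {G : SimpleGraph V} {γ : ℝ} [Finite V]
    (hγ₀ : 0 < γ) (hγ₁ : γ < 1) (hc : 2 ≤ c) {x : V → ℕ} (hx : IsPathCoord G x) {s₀ : State V c}
    (hs₀ : ¬ s₀.IsCapture) {v : Fin (c + 1) → State V c → ℝ}
    (hv : ∀ m, IsBellman G γ 0 m (v m))
    (hcom : ∀ s, Reachable G s₀ s → ¬ s.IsCapture → ∀ m, ∃ w, s.Legal G w ∧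
      v m s = γ * v m (s.next w) ∧ v (Fin.last c) s = γ * v (Fin.last c) (s.next w)) :
    (s₀.DownSided x → γ ≤ 1 / (c : ℝ)) ∧
      (s₀.DownSided x ∨ ∀ i : Fin c, x (s₀.pos i.castSucc) < x (s₀.pos (Fin.last c))) := by
  have hr₀ : ReachablePos G s₀ s₀.pos :=
    Reachable.reachablePos (n := s₀.mover) ⟨[], .start⟩ fun i hi => hs₀ ⟨i, hi⟩
  let z : Fin c := ⟨0, by omega⟩
  have main : ∀ p, ReachablePos G s₀ p → G.Adj (p (Fin.last c)) (p z.castSucc) →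
      (∀ u, G.Adj (p (Fin.last c)) u → ∃ i : Fin c, p i.castSucc = u) →
      ∀ u, G.Adj (p (Fin.last c)) u →
        γ ≤ reward 0 z.castSucc (State.next ⟨p, Fin.last c⟩ u) := by
    intro p hp hadj hnbr u hu
    obtain ⟨w, h1, h2, h3⟩ := hcom ⟨p, Fin.last c⟩ (hp.reachable _) (hp.not_isCapture _) z.castSucc
    exact le_reward_of_common_greedy rfl (hv _) (hv _) hγ₀ hγ₁ rfl (hp.not_isCapture _) hadj hnbr
      h1 h2 h3 hu
  constructor
  · intro hd
    obtain ⟨p, hp, hpd, hp0⟩ := hr₀.exists_robber_at_zero hx hd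
    obtain ⟨q, hq, hql, hqa⟩ := hp.exists_adjacent hx
    have hq1 : ∀ i : Fin c, x (q i.castSucc) = 1 := fun i => by
      have := hqa i
      omega
    have hq0 : x (q (Fin.last c)) = 0 := by rw [hql, hp0]
    have hadj : G.Adj (q (Fin.last c)) (q z.castSucc) := by
      rw [hx.adj_iff, hq1, hq0]
      omega
    have := main q hq hadj (fun u hu => ⟨z, hx.inj (by
      rw [hx.adj_iff, hq0] at hu
      have := hq1 z
      omega)⟩) _ hadj
    have hall : ∀ i : Fin c, (State.next ⟨q, Fin.last c⟩ (q z.castSucc)).pos i.castSucc =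
        (State.next ⟨q, Fin.last c⟩ (q z.castSucc)).pos (Fin.last c) := fun i => by
      rw [State.next_pos_of_mover rfl, State.next_pos_of_ne (last_ne_castSucc i)]
      exact hx.inj (by rw [hq1, hq1])
    rwa [reward_of_pos_eq (hall z), (captors_eq_iff _).2 hall] at this
  · by_contra! hcon
    obtain ⟨h1, j, hj⟩ := hcon
    unfold State.DownSided at h1
    push Not at h1
    obtain ⟨i, hi⟩ := h1
    obtain ⟨q, hq, hql, hqa⟩ := hr₀.exists_adjacent hx
    rw [← hql] at hqa hi hj
    have hi1 : x (q i.castSucc) + 1 = x (q (Fin.last c)) := by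
      have := hqa i
      omega
    have hj1 : x (q j.castSucc) = x (q (Fin.last c)) + 1 := by
      have := hqa j
      have := hx.inj.ne (hr₀.ne j)
      rw [← hql] at this
      omega
    have hadj : ∀ k : Fin c, G.Adj (q (Fin.last c)) (q k.castSucc) := fun k => by
      have := hqa k
      rw [hx.adj_iff]
      omega
    have key := main q hq (hadj z) fun u hu => by
      rw [hx.adj_iff] at hu
      rcases hu with hu | hu
      · exact ⟨j, hx.inj (by omega)⟩
      · exact ⟨i, hx.inj (by omega)⟩
    -- Both sides are occupied, so some cop `k` is opposite to the first cop. A robber who runs into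
    -- `k` leaves the first cop with reward `0`, which contradicts `0 < γ`.
    have hex : ∃ k : Fin c, x (q z.castSucc) ≠ x (q k.castSucc) := by
      by_contra! hall
      have := hall i
      have := hall j
      omega
    obtain ⟨k, hk⟩ := hex
    have := key _ (hadj k)
    rw [reward_of_pos_ne] at this
    · linarith
    · rw [State.next_pos_of_mover rfl, State.next_pos_of_ne (last_ne_castSucc z)]
      exact fun h => hk (congrArg x h)

/-! ### Sufficiency and conclusion -/

/-- Optimality is required at all states, so at unreachable ones each game uses its own greedy move.
At reachable ones the common move is used in every game, and it no longer matters who has deviated.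
-/
theorem exists_family_of_common_greedy {G : SimpleGraph V} {γ : ℝ} [Finite V]
    (hγ₀ : 0 ≤ γ) (hγ₁ : γ < 1) {s₀ : State V c} {v : Fin (c + 1) → State V c → ℝ}
    (hv : ∀ m, IsBellman G γ 0 m (v m))
    (hcom : ∀ s, Reachable G s₀ s → ¬ s.IsCapture → ∃ w, s.Legal G w ∧
      ∀ m, v m s = γ * v m (s.next w)) :
    ∃ φ : Fin (c + 1) → Profile G c,
      IsTriggerFamily γ 0 φ ∧ IsPositional γ 0 s₀ φ ∧ IsHistoryIndependent s₀ φ := by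
  have hex : ∀ s : State V c, ∃ F : Fin (c + 1) → V, (∀ m, s.Legal G (F m)) ∧
      (¬ s.IsCapture → ∀ m, v m s = γ * v m (s.next (F m))) ∧
      (Reachable G s₀ s → ¬ s.IsCapture → ∀ m m', F m = F m') := by
    intro s
    by_cases hs : s.IsCapture
    · exact ⟨fun _ => s.pos s.mover, fun _ => s.legal_stay G, fun h => absurd hs h,
        fun _ h => absurd hs h⟩
    by_cases hr : Reachable G s₀ s
    · obtain ⟨w, h1, h2⟩ := hcom s hr hs
      exact ⟨fun _ => w, fun _ => h1, fun _ => h2, fun _ _ _ _ => rfl⟩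
    · choose F h1 h2 using fun m => (hv m).greedy s hs
      exact ⟨F, h1, fun _ => h2, fun h => absurd h hr⟩
  choose F hleg hgr heq using hex
  let φ : Fin (c + 1) → Profile G c := fun m n => ⟨fun s => F s m, fun s _ => hleg s m⟩
  have hopt : IsTriggerFamily γ 0 φ := fun m =>
    ((hv m).isOptimal_iff hγ₀ hγ₁ (φ m)).2 fun s hs => hgr s hs m
  refine ⟨φ, hopt, fun n m => ?_, fun n => ?_⟩
  · exact ⟨φ (Fin.last c) n, ⟨φ (Fin.last c), hopt _, rfl⟩,
      fun s h hh _ hs => heq s ⟨h, hh⟩ hs _ _⟩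
  · refine ⟨fun s => F s n, fun s h hh _ hs => ?_⟩
    unfold triggerMove
    split
    · rfl
    · exact heq s ⟨h, hh⟩ hs _ _

theorem Reachable.downSided {G : SimpleGraph V} {x : V → ℕ} (hx : IsPathCoord G x)
    {s₀ s : State V c} (h₀ : s₀.DownSided x) (h : Reachable G s₀ s) (hs : ¬ s.IsCapture) :
    s.DownSided x := by
  obtain ⟨l, hl⟩ := h
  have key : ∀ l, IsHistory G s₀ l → ∀ s ∈ l.head?, ¬ s.IsCapture → s.DownSided x := by
    intro l hl
    induction hl with
    | start =>
      rintro s ⟨⟩ _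
      exact h₀
    | step s l w hl hs hw ih =>
      rintro t ⟨⟩ ht
      exact ((ih s rfl hs).next hx hw).resolve_left ht
  exact key _ hl s rfl hs

theorem exists_family_of_downSided {G : SimpleGraph V} {γ : ℝ} [Finite V] (hc : 2 ≤ c)
    (hγ₀ : 0 < γ) (hγ₁ : γ < 1) (hγc : γ ≤ 1 / (c : ℝ)) {x : V → ℕ} (hx : IsPathCoord G x)
    {s₀ : State V c} (h₀ : s₀.DownSided x) {v : Fin (c + 1) → State V c → ℝ}
    (hv : ∀ m, IsBellman G γ 0 m (v m)) :
    ∃ φ : Fin (c + 1) → Profile G c,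
      IsTriggerFamily γ 0 φ ∧ IsPositional γ 0 s₀ φ ∧ IsHistoryIndependent s₀ φ := by
  have : Nonempty (Fin c) := ⟨⟨0, by omega⟩⟩
  obtain ⟨μ, hμ⟩ := hx.exists_toward
  refine exists_family_of_common_greedy hγ₀.le hγ₁ hv fun s hr hs => ?_
  have hd := hr.downSided hx h₀ hs
  refine ⟨μ (s.pos s.mover), hx.legal_toward (hμ _), fun m => ?_⟩
  rcases Fin.eq_castSucc_or_eq_last m with ⟨k, rfl⟩ | rfl
  · exact (hv _).greedy_castSucc hγ₀ hγ₁ hγc hx hd (hμ _)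
  · exact (hv _).greedy_last hγ₀ hγ₁ hx hd (hμ _)

end SCAR

theorem mainTheorem5 {V : Type*} [Fintype V] (G : SimpleGraph V)
    (e : G ≃g SimpleGraph.pathGraph (Fintype.card V)) (hV : 3 ≤ Fintype.card V)
    (c : ℕ) (hc : 2 ≤ c) (γ : ℝ) (hγ₀ : 0 < γ) (hγ₁ : γ < 1)
    (s₀ : SCAR.State V c) (hs₀ : ¬ s₀.IsCapture) :
    ((∃ φ : Fin (c + 1) → SCAR.Profile G c,
        SCAR.IsTriggerFamily γ 0 φ ∧ SCAR.IsPositional γ 0 s₀ φ) ↔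
      s₀.OneSided e ∧ γ ≤ 1 / (c : ℝ)) ∧
    (s₀.OneSided e ∧ γ ≤ 1 / (c : ℝ) →
      ∃ φ : Fin (c + 1) → SCAR.Profile G c,
        SCAR.IsTriggerFamily γ 0 φ ∧ SCAR.IsPositional γ 0 s₀ φ ∧
          SCAR.IsHistoryIndependent s₀ φ) := by
  choose v hv using fun m : Fin (c + 1) => SCAR.exists_isBellman G 0 hγ₀.le hγ₁ m
  have hx := SCAR.isPathCoord_val e
  have hx' := SCAR.isPathCoord_rev e
  have hside : s₀.OneSided e ↔ s₀.DownSided (fun u => (e u).val) ∨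
      s₀.DownSided (fun u => Fintype.card V - 1 - (e u).val) := by
    rw [or_comm]
    refine or_congr (forall_congr' fun i => ?_) Iff.rfl
    simp only [Fin.lt_def]
    have := (e (s₀.pos i.castSucc)).isLt
    have := (e (s₀.pos (Fin.last c))).isLt
    omega
  have suff : s₀.OneSided e ∧ γ ≤ 1 / (c : ℝ) →
      ∃ φ : Fin (c + 1) → SCAR.Profile G c,
        SCAR.IsTriggerFamily γ 0 φ ∧ SCAR.IsPositional γ 0 s₀ φ ∧
          SCAR.IsHistoryIndependent s₀ φ := by
    rintro ⟨h, hγc⟩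
    rcases hside.1 h with h | h
    · exact SCAR.exists_family_of_downSided hc hγ₀ hγ₁ hγc hx h hv
    · exact SCAR.exists_family_of_downSided hc hγ₀ hγ₁ hγc hx' h hv
  refine ⟨⟨?_, fun h => ?_⟩, suff⟩
  · rintro ⟨φ, h1, h2⟩
    have hcom := fun s hr hs =>
      SCAR.exists_common_greedy_of_isPositional (s := s) hγ₀.le hγ₁ hv h1 h2 hr hs
    -- One orientation suffices for one-sidedness; the bound on `γ` needs the orientation in which
    -- the cops lie above the robber.
    obtain ⟨h3, h4⟩ := SCAR.le_of_common_greedy hγ₀ hγ₁ hc hx hs₀ hv hcom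
    obtain ⟨h5, -⟩ := SCAR.le_of_common_greedy hγ₀ hγ₁ hc hx' hs₀ hv hcom
    have h6 : s₀.OneSided e := h4.symm
    exact ⟨h6, (hside.1 h6).elim h3 h5⟩
  · obtain ⟨φ, h1, h2, -⟩ := suff h
    exact ⟨φ, h1, h2⟩
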